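/- Assume the standard model of floating-point arithmetic with unit roundoff $u>0$: each operation $+,-,\times,/,\sqrt{\cdot}$ on real numbers returns its exact result multiplied by $1+\delta$ for some $|\delta|\le u$ (which may differ from operation to operation), and no overflow or underflow occurs. Let $m\ge n$ and let $X\in\mathbb{R}^{m\times n}$ have full column rank and satisfy $$8\,\kappa_2(X)\sqrt{mnu+n(n+1)u}\le 1,\qquad \kappa_2(X)=\|X\|_2/\sigma_n(X).$$ Let CholeskyQR2 be applied to $X$ in this arithmetic, that is, $$\hat A=fl(X^\top X),\quad \hat R=fl(\mathrm{chol}(\hat A)),\quad \hat Y=fl(X\hat R^{-1}),$$ $$\hat C=fl(\hat Y^\top \hat Y),\quad \hat S=fl(\mathrm{chol}(\hat C)),\quad \hat Z=fl(\hat Y\hat S^{-1}),\quad \hat U=fl(\hat S\hat R),$$ where matrix products are computed by conventional multiplication, $\mathrm{chol}$ is the standard algorithm for the upper triangular Cholesky factor, $\hat Y$ and $\hat Z$ are computed row by row by substitution, and all sums may be evaluated in any order. Then neither Cholesky factorization can break down (every computed pivot is positive), and the computed factors satisfy $$\|\hat Z\hat U-X\|_F\le 5n^2u\,\|X\|_2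 .$$ -/

import Mathlib

namespace FloatQR

noncomputable section

/-! ### Norms and condition number -/

/-- The spectral norm `‖A‖₂`, the operator norm for the Euclidean norms. -/
def specNorm {m n : ℕ} (A : Matrix (Fin m) (Fin n) ℝ) : ℝ :=
  ‖LinearMap.toContinuousLinearMap (Matrix.toEuclideanLin A)‖

/-- The Frobenius norm `‖A‖_F`. -/
def frobNorm {m n : ℕ} (A : Matrix (Fin m) (Fin n) ℝ) : ℝ :=
  √(∑ i, ∑ j, A i j ^ 2)

/-- The 2-norm condition number `κ₂(A) = ‖A‖₂ / σₙ(A)` of a matrix with `n` columns. Mathlib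
numbers the singular values in decreasing order from `0`, so that `σₙ` has index `n - 1`.
(Meaningful for `n ≥ 1` and `A` of full column rank.) -/
def cond {m n : ℕ} (A : Matrix (Fin m) (Fin n) ℝ) : ℝ :=
  specNorm A / (Matrix.toEuclideanLin A).singularValues (n - 1)

/-! ### The standard model of floating-point arithmetic

Every elementary operation `+, -, *, /, √` returns its exact result times `1 + δ` with `|δ| ≤ u`;
`δ` may be different at every operation. All that is defined below are relations
"the result may be computed as ...", so that a statement about all related values is a statement
about every arithmetic that obeys the model. -/

/-- `y` is a possible rounded value of the exact value `x`: `y = x (1 + δ)` with `|δ| ≤ u`. -/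
def Rounds (u x y : ℝ) : Prop :=
  ∃ δ : ℝ, |δ| ≤ u ∧ y = x * (1 + δ)

/-- `FlSum u f s y`: the value `y` may be obtained by summing the numbers `f i`, `i ∈ s`, by
floating-point additions, in any order and with any bracketing. -/
inductive FlSum (u : ℝ) {ι : Type} (f : ι → ℝ) : Finset ι → ℝ → Prop
  | single (i : ι) : FlSum u f {i} (f i)
  | add {s t : Finset ι} (hst : Disjoint s t) {a b c : ℝ} :
      FlSum u f s a → FlSum u f t b → Rounds u (a + b) c → FlSum u f (s.disjUnion t hst) c

/-- `y` is a computed value of the inner product `∑ k, a k * b k`. -/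
def FlDot (u : ℝ) {n : ℕ} (a b : Fin n → ℝ) (y : ℝ) : Prop :=
  ∃ p : Fin n → ℝ, (∀ k, Rounds u (a k * b k) (p k)) ∧ FlSum u p Finset.univ y

/-- `y` is a computed value of `c - ∑ k ∈ s, a k * b k`: the products are rounded, and then `c`
(the term of index `none`) and the negated products are summed. Negation is exact. -/
def FlSubDot (u c : ℝ) {n : ℕ} (s : Finset (Fin n)) (a b : Fin n → ℝ) (y : ℝ) : Prop :=
  ∃ p : Fin n → ℝ, (∀ k ∈ s, Rounds u (a k * b k) (p k)) ∧
    FlSum u (fun o : Option (Fin n) => o.elim c (fun k => -p k)) (Finset.insertNone s) y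

/-- `C` is a computed value of the matrix product `A * B` (conventional multiplication). -/
def FlMul (u : ℝ) {l m n : ℕ} (A : Matrix (Fin l) (Fin m) ℝ) (B : Matrix (Fin m) (Fin n) ℝ)
    (C : Matrix (Fin l) (Fin n) ℝ) : Prop :=
  ∀ i j, FlDot u (fun k => A i k) (fun k => B k j) (C i j)

/-! ### Cholesky factorization `A = Rᵀ R` (only the upper triangle of `A` is read) -/

/-- The off-diagonal entry `R i j`, `i < j`, is computed as
`(A i j - ∑ k < i, R k i * R k j) / R i i`. -/
def CholEntry (u : ℝ) {n : ℕ} (A R : Matrix (Fin n) (Fin n) ℝ) (i j : Fin n) : Prop :=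
  ∃ t : ℝ, FlSubDot u (A i j) (Finset.Iio i) (fun k => R k i) (fun k => R k j) t ∧
    Rounds u (t / R i i) (R i j)

/-- `t` is a computed value of the `j`-th pivot `A j j - ∑ k < j, R k j ^ 2`. -/
def CholPivot (u : ℝ) {n : ℕ} (A R : Matrix (Fin n) (Fin n) ℝ) (j : Fin n) (t : ℝ) : Prop :=
  FlSubDot u (A j j) (Finset.Iio j) (fun k => R k j) (fun k => R k j) t

/-- The diagonal entry `R j j` is computed as the square root of a positive pivot. -/
def CholDiag (u : ℝ) {n : ℕ} (A R : Matrix (Fin n) (Fin n) ℝ) (j : Fin n) : Prop :=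
  ∃ t : ℝ, CholPivot u A R j t ∧ 0 < t ∧ Rounds u (√t) (R j j)

/-- The computed Cholesky factorization of `A` runs to completion with the upper triangular
factor `R`. -/
def FlChol (u : ℝ) {n : ℕ} (A R : Matrix (Fin n) (Fin n) ℝ) : Prop :=
  (∀ i j, j < i → R i j = 0) ∧ (∀ i j, i < j → CholEntry u A R i j) ∧ ∀ j, CholDiag u A R j

/-- The computed Cholesky factorization of `A` can break down: after successful computation of
all columns before some column `p`, and of the entries of column `p` above the diagonal, the
computed pivot of column `p` is not positive. -/
def FlCholBreaksDown (u : ℝ) {n : ℕ} (A : Matrix (Fin n) (Fin n) ℝ) : Prop :=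
  ∃ (R : Matrix (Fin n) (Fin n) ℝ) (p : Fin n) (t : ℝ),
    (∀ i j, i < j → j ≤ p → CholEntry u A R i j) ∧ (∀ j, j < p → CholDiag u A R j) ∧
      CholPivot u A R p t ∧ t ≤ 0

/-! ### Triangular solution, CholeskyQR and CholeskyQR2 -/

/-- `Y` is a computed value of `X * R⁻¹` for upper triangular `R`: each row of `Y` is obtained by
substitution, `Y i j = (X i j - ∑ k < j, Y i k * R k j) / R j j`. -/
def FlTriSolve (u : ℝ) {m n : ℕ} (X : Matrix (Fin m) (Fin n) ℝ) (R : Matrix (Fin n) (Fin n) ℝ)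
    (Y : Matrix (Fin m) (Fin n) ℝ) : Prop :=
  ∀ i j, ∃ t : ℝ,
    FlSubDot u (X i j) (Finset.Iio j) (fun k => Y i k) (fun k => R k j) t ∧
      Rounds u (t / R j j) (Y i j)

/-- CholeskyQR may return `Q`, `R` on `X`: `A = fl(Xᵀ X)`, `R = fl(chol A)`, `Q = fl(X R⁻¹)`. -/
def CholeskyQR (u : ℝ) {m n : ℕ} (X Q : Matrix (Fin m) (Fin n) ℝ)
    (R : Matrix (Fin n) (Fin n) ℝ) : Prop :=
  ∃ A : Matrix (Fin n) (Fin n) ℝ, FlMul u X.transpose X A ∧ FlChol u A R ∧ FlTriSolve u X R Q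

/-- CholeskyQR can break down on `X` (in its Cholesky factorization). -/
def CholeskyQRBreaksDown (u : ℝ) {m n : ℕ} (X : Matrix (Fin m) (Fin n) ℝ) : Prop :=
  ∃ A : Matrix (Fin n) (Fin n) ℝ, FlMul u X.transpose X A ∧ FlCholBreaksDown u A

/-- CholeskyQR2 may return `Z`, `U` on `X`: CholeskyQR on `X` gives `Y`, `R`, CholeskyQR on `Y`
gives `Z`, `S`, and `U = fl(S R)`. -/
def CholeskyQR2 (u : ℝ) {m n : ℕ} (X Z : Matrix (Fin m) (Fin n) ℝ)
    (U : Matrix (Fin n) (Fin n) ℝ) : Prop :=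
  ∃ (Y : Matrix (Fin m) (Fin n) ℝ) (R S : Matrix (Fin n) (Fin n) ℝ),
    CholeskyQR u X Y R ∧ CholeskyQR u Y Z S ∧ FlMul u S R U

/-- CholeskyQR2 can break down on `X`, in the first or in the second Cholesky factorization. -/
def CholeskyQR2BreaksDown (u : ℝ) {m n : ℕ} (X : Matrix (Fin m) (Fin n) ℝ) : Prop :=
  CholeskyQRBreaksDown u X ∨
    ∃ (Y : Matrix (Fin m) (Fin n) ℝ) (R : Matrix (Fin n) (Fin n) ℝ),
      CholeskyQR u X Y R ∧ CholeskyQRBreaksDown u Y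

end

end FloatQR

namespace FloatQR

/-! ### Euclidean and Frobenius norms -/

/-- The Euclidean norm of a vector. -/
noncomputable def vecNorm {n : ℕ} (v : Fin n → ℝ) : ℝ := ‖WithLp.toLp 2 v‖

theorem vecNorm_nonneg {n : ℕ} (v : Fin n → ℝ) : 0 ≤ vecNorm v := norm_nonneg _

theorem vecNorm_sq {n : ℕ} (v : Fin n → ℝ) : vecNorm v ^ 2 = ∑ i, v i ^ 2 := by
  simp [vecNorm, EuclideanSpace.norm_sq_eq]

theorem vecNorm_add_le {n : ℕ} (v w : Fin n → ℝ) : vecNorm (v + w) ≤ vecNorm v + vecNorm w :=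
  norm_add_le (WithLp.toLp 2 v) (WithLp.toLp 2 w)

theorem vecNorm_sub_le {n : ℕ} (v w : Fin n → ℝ) : vecNorm (v - w) ≤ vecNorm v + vecNorm w :=
  norm_sub_le (WithLp.toLp 2 v) (WithLp.toLp 2 w)

theorem vecNorm_pos {n : ℕ} {v : Fin n → ℝ} (hv : v ≠ 0) : 0 < vecNorm v := by
  refine norm_pos_iff.mpr fun h => hv ?_
  simpa using congrArg WithLp.ofLp h

theorem sum_mul_le_vecNorm {n : ℕ} (a b : Fin n → ℝ) :
    ∑ i, a i * b i ≤ vecNorm a * vecNorm b := by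
  refine le_of_sq_le_sq ?_ (mul_nonneg (vecNorm_nonneg _) (vecNorm_nonneg _))
  rw [mul_pow, vecNorm_sq, vecNorm_sq]
  exact Finset.sum_mul_sq_le_sq_mul_sq _ _ _

theorem vecNorm_abs {n : ℕ} (v : Fin n → ℝ) : vecNorm (fun i => |v i|) = vecNorm v := by
  refine (pow_left_inj₀ (vecNorm_nonneg _) (vecNorm_nonneg _) two_ne_zero).mp ?_
  simp [vecNorm_sq]

theorem sum_abs_mul_abs_le {n : ℕ} (a b : Fin n → ℝ) :
    ∑ i, |a i| * |b i| ≤ vecNorm a * vecNorm b := by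
  simpa only [vecNorm_abs] using sum_mul_le_vecNorm (fun i => |a i|) (fun i => |b i|)

theorem vecNorm_single {n : ℕ} (j : Fin n) : vecNorm (Pi.single j (1 : ℝ)) = 1 := by
  simp [vecNorm]

theorem frobNorm_nonneg {m n : ℕ} (A : Matrix (Fin m) (Fin n) ℝ) : 0 ≤ frobNorm A :=
  Real.sqrt_nonneg _

theorem frobNorm_sq {m n : ℕ} (A : Matrix (Fin m) (Fin n) ℝ) :
    frobNorm A ^ 2 = ∑ i, ∑ j, A i j ^ 2 :=
  Real.sq_sqrt (Finset.sum_nonneg fun _ _ => Finset.sum_nonneg fun _ _ => sq_nonneg _)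

theorem frobNorm_sq_eq_sum_row {m n : ℕ} (A : Matrix (Fin m) (Fin n) ℝ) :
    frobNorm A ^ 2 = ∑ i, vecNorm (A i) ^ 2 := by
  simp [frobNorm_sq, vecNorm_sq]

theorem frobNorm_sq_eq_sum_col {m n : ℕ} (A : Matrix (Fin m) (Fin n) ℝ) :
    frobNorm A ^ 2 = ∑ j, vecNorm (fun i => A i j) ^ 2 := by
  simp only [frobNorm_sq, vecNorm_sq]
  exact Finset.sum_comm

attribute [local instance] Matrix.frobeniusNormedAddCommGroup in
theorem frobNorm_eq_norm {m n : ℕ} (A : Matrix (Fin m) (Fin n) ℝ) : frobNorm A = ‖A‖ := by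
  simp [Matrix.frobenius_norm_def, frobNorm, Real.sqrt_eq_rpow]

theorem frobNorm_add_le {m n : ℕ} (A B : Matrix (Fin m) (Fin n) ℝ) :
    frobNorm (A + B) ≤ frobNorm A + frobNorm B := by
  simp only [frobNorm_eq_norm]
  exact @norm_add_le _ Matrix.frobeniusNormedAddCommGroup.toNormedAddGroup.toSeminormedAddGroup A B

theorem vecNorm_mulVec_le_frobNorm {m n : ℕ} (A : Matrix (Fin m) (Fin n) ℝ) (v : Fin n → ℝ) :
    vecNorm (A.mulVec v) ≤ frobNorm A * vecNorm v := by
  refine le_of_sq_le_sq ?_ (mul_nonneg (frobNorm_nonneg _) (vecNorm_nonneg _))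
  rw [mul_pow, frobNorm_sq_eq_sum_row, vecNorm_sq (A.mulVec v), Finset.sum_mul]
  refine Finset.sum_le_sum fun i _ => ?_
  rw [vecNorm_sq, vecNorm_sq]
  exact Finset.sum_mul_sq_le_sq_mul_sq Finset.univ (A i) v

theorem frobNorm_mul_le_of_left {l m n : ℕ} {A : Matrix (Fin l) (Fin m) ℝ} {B : ℝ} (hB : 0 ≤ B)
    (hA : ∀ v, vecNorm (A.mulVec v) ≤ B * vecNorm v) (E : Matrix (Fin m) (Fin n) ℝ) :
    frobNorm (A * E) ≤ B * frobNorm E := by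
  refine le_of_sq_le_sq ?_ (mul_nonneg hB (frobNorm_nonneg _))
  rw [mul_pow, frobNorm_sq_eq_sum_col, frobNorm_sq_eq_sum_col, Finset.mul_sum]
  refine Finset.sum_le_sum fun j _ => ?_
  rw [← mul_pow]
  exact pow_le_pow_left₀ (vecNorm_nonneg _) (hA fun i => E i j) 2

theorem vecNorm_vecMul_le {m n : ℕ} {A : Matrix (Fin m) (Fin n) ℝ} {B : ℝ} (hB : 0 ≤ B)
    (hA : ∀ v, vecNorm (A.mulVec v) ≤ B * vecNorm v) (d : Fin m → ℝ) :
    vecNorm (Matrix.vecMul d A) ≤ B * vecNorm d := by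
  have h1 : vecNorm (Matrix.vecMul d A) ^ 2 ≤
      vecNorm d * (B * vecNorm (Matrix.vecMul d A)) := by
    have h2 : vecNorm (Matrix.vecMul d A) ^ 2 =
        ∑ i, d i * A.mulVec (Matrix.vecMul d A) i := by
      rw [vecNorm_sq]
      have := Matrix.dotProduct_mulVec d A (Matrix.vecMul d A)
      simp only [dotProduct] at this
      rw [this]
      exact Finset.sum_congr rfl fun i _ => sq _
    rw [h2]
    exact (sum_mul_le_vecNorm _ _).trans
      (mul_le_mul_of_nonneg_left (hA _) (vecNorm_nonneg _))
  rcases (vecNorm_nonneg (Matrix.vecMul d A)).eq_or_lt with h0 | h0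
  · rw [← h0]
    exact mul_nonneg hB (vecNorm_nonneg _)
  · nlinarith

theorem frobNorm_mul_le_of_right {l m n : ℕ} {A : Matrix (Fin m) (Fin n) ℝ} {B : ℝ} (hB : 0 ≤ B)
    (hA : ∀ v, vecNorm (A.mulVec v) ≤ B * vecNorm v) (D : Matrix (Fin l) (Fin m) ℝ) :
    frobNorm (D * A) ≤ B * frobNorm D := by
  refine le_of_sq_le_sq ?_ (mul_nonneg hB (frobNorm_nonneg _))
  rw [mul_pow, frobNorm_sq_eq_sum_row, frobNorm_sq_eq_sum_row, Finset.mul_sum]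
  refine Finset.sum_le_sum fun i _ => ?_
  rw [← mul_pow]
  exact pow_le_pow_left₀ (vecNorm_nonneg _) (vecNorm_vecMul_le hB hA (D i)) 2

theorem frobNorm_le_of_abs_le {l m n : ℕ} {A : Matrix (Fin l) (Fin m) ℝ}
    {B : Matrix (Fin m) (Fin n) ℝ} {D : Matrix (Fin l) (Fin n) ℝ} {g : ℝ} (hg : 0 ≤ g)
    (h : ∀ i j, |D i j| ≤ g * ∑ k, |A i k| * |B k j|) :
    frobNorm D ≤ g * (frobNorm A * frobNorm B) := by
  refine le_of_sq_le_sq ?_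
    (mul_nonneg hg (mul_nonneg (frobNorm_nonneg _) (frobNorm_nonneg _)))
  rw [mul_pow, mul_pow, frobNorm_sq, frobNorm_sq_eq_sum_row A, frobNorm_sq_eq_sum_col B,
    Finset.sum_mul_sum, Finset.mul_sum]
  refine Finset.sum_le_sum fun i _ => ?_
  rw [Finset.mul_sum]
  refine Finset.sum_le_sum fun j _ => ?_
  rw [← mul_pow, ← mul_pow]
  refine sq_le_sq' ?_ ?_
  all_goals
    have := (h i j).trans (mul_le_mul_of_nonneg_left (sum_abs_mul_abs_le _ fun k => B k j) hg)
    linarith [abs_le.mp this]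

/-! ### Extreme singular values -/

theorem vecNorm_mulVec_le_specNorm {m n : ℕ} (X : Matrix (Fin m) (Fin n) ℝ) (v : Fin n → ℝ) :
    vecNorm (X.mulVec v) ≤ specNorm X * vecNorm v :=
  (LinearMap.toContinuousLinearMap (Matrix.toEuclideanLin X)).le_opNorm (WithLp.toLp 2 v)

theorem singularValues_mul_norm_le {E F : Type*} [NormedAddCommGroup E] [InnerProductSpace ℝ E]
    [FiniteDimensional ℝ E] [NormedAddCommGroup F] [InnerProductSpace ℝ F]
    [FiniteDimensional ℝ F] (T : E →ₗ[ℝ] F) (v : E) :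
    T.singularValues (Module.finrank ℝ E - 1) * ‖v‖ ≤ ‖T v‖ := by
  set n := Module.finrank ℝ E with hn
  have hT := T.isSymmetric_adjoint_comp_self
  refine le_of_sq_le_sq ?_ (norm_nonneg _)
  have h1 : ‖T v‖ ^ 2 = ∑ i, hT.eigenvalues rfl i * (hT.eigenvectorBasis rfl).repr v i ^ 2 := by
    rw [← real_inner_self_eq_norm_sq, ← LinearMap.adjoint_inner_left,
      ← (hT.eigenvectorBasis rfl).sum_inner_mul_inner]
    refine Finset.sum_congr rfl fun i _ => ?_
    rw [real_inner_comm, ← OrthonormalBasis.repr_apply_apply, ← OrthonormalBasis.repr_apply_apply,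
      ← LinearMap.comp_apply, hT.eigenvectorBasis_apply_self_apply]
    simp
    ring
  have h2 : ‖v‖ ^ 2 = ∑ i, (hT.eigenvectorBasis rfl).repr v i ^ 2 := by
    rw [← (hT.eigenvectorBasis rfl).repr.norm_map v, EuclideanSpace.norm_sq_eq]
    simp
  rw [mul_pow, h1, h2, Finset.mul_sum]
  refine Finset.sum_le_sum fun i _ => mul_le_mul_of_nonneg_right ?_ (sq_nonneg _)
  have hi := i.isLt
  rw [T.sq_singularValues_of_lt rfl (i := n - 1) (by omega)]
  exact hT.eigenvalues_antitone rfl (by rw [Fin.le_def]; simp only; omega)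

theorem singularValues_mul_vecNorm_le {m n : ℕ} (X : Matrix (Fin m) (Fin n) ℝ) (v : Fin n → ℝ) :
    (Matrix.toEuclideanLin X).singularValues (n - 1) * vecNorm v ≤ vecNorm (X.mulVec v) := by
  simpa [vecNorm] using singularValues_mul_norm_le (Matrix.toEuclideanLin X) (WithLp.toLp 2 v)

theorem singularValues_pos_of_rank_eq {m n : ℕ} (hn : 0 < n) {X : Matrix (Fin m) (Fin n) ℝ}
    (hX : X.rank = n) : 0 < (Matrix.toEuclideanLin X).singularValues (n - 1) := by
  rw [LinearMap.singularValues_pos_iff_lt_finrank_range,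
    Matrix.toEuclideanLin_eq_toLin_orthonormal, ← Matrix.rank_eq_finrank_range_toLin, hX]
  omega

/-! ### Rounding errors of sums and inner products -/

/-- An upper bound for the quotients of exact and rounded values, in both directions. -/
noncomputable def infl (u : ℝ) : ℝ := (1 - u)⁻¹

theorem one_le_infl {u : ℝ} (hu : 0 ≤ u) (hu1 : u < 1) : 1 ≤ infl u :=
  (one_le_inv₀ (by linarith)).mpr (by linarith)

theorem infl_mul {u : ℝ} (hu1 : u < 1) : infl u * (1 - u) = 1 :=
  inv_mul_cancel₀ (by linarith)

theorem infl_pow_sub_one_nonneg {u : ℝ} (hu : 0 ≤ u) (hu1 : u < 1) (k : ℕ) :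
    0 ≤ infl u ^ k - 1 :=
  sub_nonneg.mpr (one_le_pow₀ (one_le_infl hu hu1))

theorem infl_pow_sub_one_le {u : ℝ} (hu1 : u < 1) (k : ℕ) (hk : k * u < 1) :
    infl u ^ k - 1 ≤ k * u / (1 - k * u) := by
  have h1 : 1 - k * u ≤ (1 - u) ^ k := by
    have := one_add_mul_le_pow (a := -u) (by linarith) k
    rw [← sub_eq_add_neg] at this
    linarith
  have h2 : (0 : ℝ) < 1 - k * u := by linarith
  have h3 : infl u ^ k ≤ (1 - k * u)⁻¹ := by
    rw [infl, inv_pow]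
    exact inv_anti₀ h2 h1
  have h4 : k * u / (1 - k * u) = (1 - k * u)⁻¹ - 1 := by field_simp; ring
  linarith

theorem Rounds.abs_sub_le {u x y : ℝ} (h : Rounds u x y) : |y - x| ≤ u * |x| := by
  obtain ⟨δ, hδ, rfl⟩ := h
  rw [show x * (1 + δ) - x = δ * x by ring, abs_mul]
  exact mul_le_mul_of_nonneg_right hδ (abs_nonneg _)

theorem Rounds.abs_sub_le_left {u x y : ℝ} (hu : 0 ≤ u) (hu1 : u < 1) (h : Rounds u x y) :
    |y - x| ≤ (infl u - 1) * |x| := by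
  refine h.abs_sub_le.trans (mul_le_mul_of_nonneg_right ?_ (abs_nonneg _))
  nlinarith [infl_mul hu1, one_le_infl hu hu1]

theorem Rounds.abs_sub_le_right {u x y : ℝ} (hu : 0 ≤ u) (hu1 : u < 1) (h : Rounds u x y) :
    |y - x| ≤ (infl u - 1) * |y| := by
  have h1 := h.abs_sub_le
  have h2 : |x| ≤ |y| + |y - x| := by
    have := abs_sub_abs_le_abs_sub x y
    rw [abs_sub_comm] at this
    linarith
  have h3 : |y - x| * (1 - u) ≤ u * |y| := by nlinarith
  have h4 : u * infl u = infl u - 1 := by linarith [infl_mul hu1]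
  have h5 := mul_le_mul_of_nonneg_left h3 (zero_le_one.trans (one_le_infl hu hu1))
  calc |y - x| = infl u * (1 - u) * |y - x| := by rw [infl_mul hu1, one_mul]
    _ = infl u * (|y - x| * (1 - u)) := by ring
    _ ≤ infl u * (u * |y|) := h5
    _ = (infl u - 1) * |y| := by rw [← h4]; ring

theorem FlSum.abs_sub_sum_le {u : ℝ} (hu : 0 ≤ u) (hu1 : u < 1) {ι : Type} {f : ι → ℝ}
    {s : Finset ι} {y : ℝ} (h : FlSum u f s y) :
    ∃ d, s.card = d + 1 ∧ |y - ∑ i ∈ s, f i| ≤ (infl u ^ d - 1) * ∑ i ∈ s, |f i| := by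
  induction h with
  | single i => exact ⟨0, by simp⟩
  | @add s t hst a b c _ _ hc iha ihb =>
    obtain ⟨d, hd, ha⟩ := iha
    obtain ⟨e, he, hb⟩ := ihb
    refine ⟨d + e + 1, by rw [Finset.card_disjUnion]; omega, ?_⟩
    rw [Finset.sum_disjUnion, Finset.sum_disjUnion]
    have hq := one_le_infl hu hu1
    have hF := Finset.sum_nonneg fun i (_ : i ∈ s) => abs_nonneg (f i)
    have hG := Finset.sum_nonneg fun i (_ : i ∈ t) => abs_nonneg (f i)
    have hFs := Finset.abs_sum_le_sum_abs f s
    have hGs := Finset.abs_sum_le_sum_abs f t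
    have hc' := hc.abs_sub_le_left hu hu1
    set F := ∑ i ∈ s, |f i|
    set G := ∑ i ∈ t, |f i|
    set A := ∑ i ∈ s, f i
    set B := ∑ i ∈ t, f i
    set q := infl u
    have hA : |a| ≤ q ^ d * F := by
      have := abs_add_le (a - A) A
      rw [sub_add_cancel] at this
      linarith
    have hB : |b| ≤ q ^ e * G := by
      have := abs_add_le (b - B) B
      rw [sub_add_cancel] at this
      linarith
    have h1 : |c - (A + B)| ≤ |c - (a + b)| + (|a - A| + |b - B|) := by
      rw [show c - (A + B) = c - (a + b) + ((a - A) + (b - B)) by ring]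
      exact (abs_add_le _ _).trans (add_le_add_right (abs_add_le _ _) _)
    have h2 : (q - 1) * |a + b| ≤ (q - 1) * (q ^ d * F + q ^ e * G) :=
      mul_le_mul_of_nonneg_left ((abs_add_le _ _).trans (add_le_add hA hB)) (by linarith)
    have h3 : q ^ (d + 1) * F ≤ q ^ (d + e + 1) * F :=
      mul_le_mul_of_nonneg_right (pow_le_pow_right₀ hq (by omega)) hF
    have h4 : q ^ (e + 1) * G ≤ q ^ (d + e + 1) * G :=
      mul_le_mul_of_nonneg_right (pow_le_pow_right₀ hq (by omega)) hG
    have h5 : q ^ (d + 1) * F = q * (q ^ d * F) := by ring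
    have h6 : q ^ (e + 1) * G = q * (q ^ e * G) := by ring
    linarith

theorem FlSum.abs_sub_sum_le_of_mem {u : ℝ} (hu : 0 ≤ u) (hu1 : u < 1) {ι : Type} [DecidableEq ι]
    {f : ι → ℝ} {s : Finset ι} {y : ℝ} (h : FlSum u f s y) {k : ι} (hk : k ∈ s) :
    ∃ d, s.card = d + 1 ∧
      |y - ∑ i ∈ s, f i| ≤ (infl u ^ d - 1) * (|y| + ∑ i ∈ s.erase k, |f i|) := by
  induction h with
  | single i => exact ⟨0, by simp⟩
  | @add s t hst a b c ha0 hb0 hc iha ihb =>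
    have key : ∀ {s t : Finset ι} {a b : ℝ}, Disjoint s t → Rounds u (a + b) c →
        (∃ d, s.card = d + 1 ∧
          |a - ∑ i ∈ s, f i| ≤ (infl u ^ d - 1) * (|a| + ∑ i ∈ s.erase k, |f i|)) →
        (∃ e, t.card = e + 1 ∧ |b - ∑ i ∈ t, f i| ≤ (infl u ^ e - 1) * ∑ i ∈ t, |f i|) →
        ∃ d, s.card + t.card = d + 1 ∧
          |c - (∑ i ∈ s, f i + ∑ i ∈ t, f i)| ≤
            (infl u ^ d - 1) * (|c| + (∑ i ∈ s.erase k, |f i| + ∑ i ∈ t, |f i|)) := by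
      rintro s t a b hst hc ⟨d, hd, ha⟩ ⟨e, he, hb⟩
      refine ⟨d + e + 1, by omega, ?_⟩
      have hq := one_le_infl hu hu1
      have hF := Finset.sum_nonneg fun i (_ : i ∈ s.erase k) => abs_nonneg (f i)
      have hG := Finset.sum_nonneg fun i (_ : i ∈ t) => abs_nonneg (f i)
      have hGs := Finset.abs_sum_le_sum_abs f t
      have hc' := hc.abs_sub_le_right hu hu1
      set F := ∑ i ∈ s.erase k, |f i|
      set G := ∑ i ∈ t, |f i|
      set A := ∑ i ∈ s, f i
      set B := ∑ i ∈ t, f i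
      set q := infl u
      have hB : |b| ≤ q ^ e * G := by
        have := abs_add_le (b - B) B
        rw [sub_add_cancel] at this
        linarith
      have hA : |a| ≤ q * |c| + q ^ e * G := by
        have h1 := abs_add_le (c - b) (a - (c - b))
        rw [add_sub_cancel] at h1
        have h2 := abs_sub c b
        rw [show a - (c - b) = -(c - (a + b)) by ring, abs_neg] at h1
        linarith
      have h1 : |c - (A + B)| ≤ |c - (a + b)| + (|a - A| + |b - B|) := by
        rw [show c - (A + B) = c - (a + b) + ((a - A) + (b - B)) by ring]
        exact (abs_add_le _ _).trans (add_le_add_right (abs_add_le _ _) _)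
      have hqd : 0 ≤ q ^ d - 1 := infl_pow_sub_one_nonneg hu hu1 d
      have h2 : (q ^ d - 1) * |a| ≤ (q ^ d - 1) * (q * |c| + q ^ e * G) :=
        mul_le_mul_of_nonneg_left hA hqd
      have h3 : q ^ (d + 1) * |c| ≤ q ^ (d + e + 1) * |c| :=
        mul_le_mul_of_nonneg_right (pow_le_pow_right₀ hq (by omega)) (abs_nonneg _)
      have h4 : q ^ (d + e) * G ≤ q ^ (d + e + 1) * G :=
        mul_le_mul_of_nonneg_right (pow_le_pow_right₀ hq (by omega)) hG
      have h5 : q ^ d * F ≤ q ^ (d + e + 1) * F :=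
        mul_le_mul_of_nonneg_right (pow_le_pow_right₀ hq (by omega)) hF
      have h6 : q ^ (d + e) * G = q ^ d * (q ^ e * G) := by ring
      have h7 : q ^ (d + 1) * |c| = q ^ d * (q * |c|) := by ring
      linarith
    rcases Finset.mem_disjUnion.mp hk with hs | ht
    · have hkt : k ∉ t := Finset.disjoint_left.mp hst hs
      obtain ⟨d, hd, h⟩ := key hst hc (iha hs) (hb0.abs_sub_sum_le hu hu1)
      refine ⟨d, by rw [Finset.card_disjUnion, hd], ?_⟩
      rw [Finset.sum_disjUnion, Finset.disjUnion_eq_union, Finset.erase_union_distrib,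
        Finset.erase_eq_of_notMem hkt, Finset.sum_union (hst.mono_left (Finset.erase_subset _ _))]
      exact h
    · have hks : k ∉ s := Finset.disjoint_right.mp hst ht
      rw [add_comm] at hc
      obtain ⟨d, hd, h⟩ := key hst.symm hc (ihb ht) (ha0.abs_sub_sum_le hu hu1)
      refine ⟨d, by rw [Finset.card_disjUnion, add_comm, hd], ?_⟩
      rw [Finset.sum_disjUnion, Finset.disjUnion_eq_union, Finset.erase_union_distrib,
        Finset.erase_eq_of_notMem hks,
        Finset.sum_union (hst.mono_right (Finset.erase_subset _ _)), add_comm (∑ i ∈ s, f i),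
        add_comm (∑ i ∈ s, |f i|)]
      exact h

theorem FlDot.abs_sub_le {u : ℝ} (hu : 0 ≤ u) (hu1 : u < 1) {n : ℕ} {a b : Fin n → ℝ} {y : ℝ}
    (h : FlDot u a b y) :
    |y - ∑ k, a k * b k| ≤ (infl u ^ n - 1) * ∑ k, |a k| * |b k| := by
  obtain ⟨p, hp, hy⟩ := h
  obtain ⟨d, hd, h⟩ := hy.abs_sub_sum_le hu hu1
  rw [Finset.card_univ, Fintype.card_fin] at hd
  subst hd
  have hpk : ∀ k, |p k - a k * b k| ≤ (infl u - 1) * (|a k| * |b k|) := fun k => by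
    rw [← abs_mul]; exact (hp k).abs_sub_le_left hu hu1
  have h1 : |∑ k, p k - ∑ k, a k * b k| ≤ (infl u - 1) * ∑ k, |a k| * |b k| := by
    rw [← Finset.sum_sub_distrib, Finset.mul_sum]
    exact (Finset.abs_sum_le_sum_abs _ _).trans (Finset.sum_le_sum fun k _ => hpk k)
  have h2 : ∑ k, |p k| ≤ infl u * ∑ k, |a k| * |b k| := by
    rw [Finset.mul_sum]
    refine Finset.sum_le_sum fun k _ => ?_
    have := abs_add_le (p k - a k * b k) (a k * b k)
    rw [sub_add_cancel, abs_mul (a k)] at this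
    linarith [hpk k]
  have h3 := mul_le_mul_of_nonneg_left h2 (infl_pow_sub_one_nonneg hu hu1 d)
  have h4 := _root_.abs_sub_le y (∑ k, p k) (∑ k, a k * b k)
  rw [pow_succ]
  linarith

theorem FlSubDot.abs_sub_le {u : ℝ} (hu : 0 ≤ u) (hu1 : u < 1) {n : ℕ} {s : Finset (Fin n)}
    {c t : ℝ} {a b : Fin n → ℝ} (h : FlSubDot u c s a b t) :
    |c - ∑ k ∈ s, a k * b k - t| ≤ (infl u ^ s.card - 1) * |t| +
      (infl u ^ (s.card + 1) - 1) * ∑ k ∈ s, |a k| * |b k| := by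
  obtain ⟨p, hp, hy⟩ := h
  obtain ⟨d, hd, h⟩ := hy.abs_sub_sum_le_of_mem hu hu1 (k := none) (by simp)
  rw [Finset.card_insertNone, Nat.add_right_cancel_iff] at hd
  subst hd
  have herase : (Finset.insertNone s).erase none = s.map Function.Embedding.some := by
    ext (_ | k) <;> simp
  rw [Finset.sum_insertNone, herase] at h
  simp only [Option.elim_none, Option.elim_some, Finset.sum_map, Function.Embedding.some_apply,
    abs_neg, Finset.sum_neg_distrib] at h
  have hpk : ∀ k ∈ s, |p k - a k * b k| ≤ (infl u - 1) * (|a k| * |b k|) := fun k hk => by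
    rw [← abs_mul]; exact (hp k hk).abs_sub_le_left hu hu1
  have h1 : |∑ k ∈ s, p k - ∑ k ∈ s, a k * b k| ≤ (infl u - 1) * ∑ k ∈ s, |a k| * |b k| := by
    rw [← Finset.sum_sub_distrib, Finset.mul_sum]
    exact (Finset.abs_sum_le_sum_abs _ _).trans (Finset.sum_le_sum hpk)
  have h2 : ∑ k ∈ s, |p k| ≤ infl u * ∑ k ∈ s, |a k| * |b k| := by
    rw [Finset.mul_sum]
    refine Finset.sum_le_sum fun k hk => ?_
    have := abs_add_le (p k - a k * b k) (a k * b k)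
    rw [sub_add_cancel, abs_mul (a k)] at this
    linarith [hpk k hk]
  have h3 := mul_le_mul_of_nonneg_left h2 (infl_pow_sub_one_nonneg hu hu1 s.card)
  have h4 : |c - ∑ k ∈ s, a k * b k - t| ≤
      |t - (c + -∑ k ∈ s, p k)| + |∑ k ∈ s, p k - ∑ k ∈ s, a k * b k| := by
    rw [abs_sub_comm t]
    refine le_trans (le_of_eq ?_) (abs_add_le _ _)
    congr 1
    ring
  rw [pow_succ]
  linarith

/-! ### Residuals of the steps of CholeskyQR -/

/-- The Euclidean norm of a column. -/
noncomputable def colNorm {m n : ℕ} (X : Matrix (Fin m) (Fin n) ℝ) (j : Fin n) : ℝ :=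
  vecNorm fun k => X k j

theorem colNorm_nonneg {m n : ℕ} (X : Matrix (Fin m) (Fin n) ℝ) (j : Fin n) : 0 ≤ colNorm X j :=
  vecNorm_nonneg _

theorem colNorm_sq {m n : ℕ} (X : Matrix (Fin m) (Fin n) ℝ) (j : Fin n) :
    colNorm X j ^ 2 = ∑ k, X k j * X k j := by
  rw [colNorm, vecNorm_sq]
  exact Finset.sum_congr rfl fun _ _ => sq _

theorem colNorm_eq_vecNorm_mulVec {m n : ℕ} (X : Matrix (Fin m) (Fin n) ℝ) (j : Fin n) :
    colNorm X j = vecNorm (X.mulVec (Pi.single j 1)) := by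
  rw [Matrix.mulVec_single_one]; rfl

theorem sum_colNorm_sq {m n : ℕ} (X : Matrix (Fin m) (Fin n) ℝ) :
    ∑ j, colNorm X j ^ 2 = frobNorm X ^ 2 :=
  (frobNorm_sq_eq_sum_col X).symm

theorem FlMul.gram_abs_sub_le {u : ℝ} (hu : 0 ≤ u) (hu1 : u < 1) {m n : ℕ}
    {X : Matrix (Fin m) (Fin n) ℝ} {A : Matrix (Fin n) (Fin n) ℝ} (h : FlMul u X.transpose X A)
    (i j : Fin n) :
    |A i j - ∑ k, X k i * X k j| ≤ (infl u ^ m - 1) * (colNorm X i * colNorm X j) :=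
  ((h i j).abs_sub_le hu hu1).trans
    (mul_le_mul_of_nonneg_left (sum_abs_mul_abs_le _ _) (infl_pow_sub_one_nonneg hu hu1 m))

theorem FlSubDot.abs_sub_mul_le {u : ℝ} (hu : 0 ≤ u) (hu1 : u < 1) {n : ℕ} {j : Fin n}
    {c t r y : ℝ} {a b : Fin n → ℝ} (h : FlSubDot u c (Finset.Iio j) a b t) (hr : r ≠ 0)
    (hy : Rounds u (t / r) y) :
    |c - ∑ k ∈ Finset.Iio j, a k * b k - y * r| ≤
      (infl u ^ n - 1) * (∑ k ∈ Finset.Iio j, |a k| * |b k| + |y| * |r|) := by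
  have h1 := h.abs_sub_le hu hu1
  rw [Fin.card_Iio] at h1
  have hq := one_le_infl hu hu1
  have h2 : |t - y * r| ≤ (infl u - 1) * (|y| * |r|) := by
    have := mul_le_mul_of_nonneg_right (hy.abs_sub_le_right hu hu1) (abs_nonneg r)
    rw [← abs_mul, sub_mul, div_mul_cancel₀ _ hr, abs_sub_comm] at this
    linarith
  have h3 : |t| ≤ infl u * (|y| * |r|) := by
    have := abs_add_le (t - y * r) (y * r)
    rw [sub_add_cancel, abs_mul y] at this
    linarith
  have h4 := mul_le_mul_of_nonneg_left h3 (infl_pow_sub_one_nonneg hu hu1 j)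
  have h5 : infl u ^ ((j : ℕ) + 1) - 1 ≤ infl u ^ n - 1 :=
    sub_le_sub_right (pow_le_pow_right₀ hq j.isLt) 1
  have hS : 0 ≤ ∑ k ∈ Finset.Iio j, |a k| * |b k| :=
    Finset.sum_nonneg fun _ _ => mul_nonneg (abs_nonneg _) (abs_nonneg _)
  refine le_trans ?_ (mul_le_mul_of_nonneg_right h5
    (add_nonneg hS (mul_nonneg (abs_nonneg y) (abs_nonneg r))))
  have h6 := abs_add_le (c - ∑ k ∈ Finset.Iio j, a k * b k - t) (t - y * r)
  rw [sub_add_sub_cancel] at h6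
  rw [pow_succ] at h1 ⊢
  linarith

theorem CholDiag.pos {u : ℝ} (hu1 : u < 1) {n : ℕ} {A R : Matrix (Fin n) (Fin n) ℝ}
    {j : Fin n} (h : CholDiag u A R j) : 0 < R j j := by
  obtain ⟨t, _, ht, δ, hδ, hR⟩ := h
  rw [hR]
  exact mul_pos (Real.sqrt_pos.mpr ht) (by linarith [abs_le.mp hδ])

theorem sum_Iic_eq {n : ℕ} (f : Fin n → ℝ) (j : Fin n) :
    ∑ k ∈ Finset.Iic j, f k = ∑ k ∈ Finset.Iio j, f k + f j := by
  rw [← Finset.Iio_insert, Finset.sum_insert (by simp), add_comm]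

theorem CholEntry.abs_sub_le {u : ℝ} (hu : 0 ≤ u) (hu1 : u < 1) {n : ℕ}
    {A R : Matrix (Fin n) (Fin n) ℝ} {i j : Fin n} (h : CholEntry u A R i j)
    (hi : CholDiag u A R i) :
    |A i j - ∑ k ∈ Finset.Iic i, R k i * R k j| ≤
      (infl u ^ (n + 1) - 1) * ∑ k ∈ Finset.Iic i, |R k i| * |R k j| := by
  obtain ⟨t, ht, hR⟩ := h
  have h1 := ht.abs_sub_mul_le hu hu1 (hi.pos hu1).ne' hR
  rw [sum_Iic_eq, sum_Iic_eq, ← sub_sub, mul_comm (R i i), mul_comm |R i i|]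
  refine h1.trans (mul_le_mul_of_nonneg_right ?_ ?_)
  · exact sub_le_sub_right (pow_le_pow_right₀ (one_le_infl hu hu1) n.le_succ) 1
  · exact add_nonneg (Finset.sum_nonneg fun _ _ => mul_nonneg (abs_nonneg _) (abs_nonneg _))
      (mul_nonneg (abs_nonneg _) (abs_nonneg _))

theorem CholDiag.abs_sub_le {u : ℝ} (hu : 0 ≤ u) (hu1 : u < 1) {n : ℕ}
    {A R : Matrix (Fin n) (Fin n) ℝ} {j : Fin n} (h : CholDiag u A R j) :
    |A j j - ∑ k ∈ Finset.Iic j, R k j * R k j| ≤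
      (infl u ^ (n + 1) - 1) * ∑ k ∈ Finset.Iic j, |R k j| * |R k j| := by
  obtain ⟨t, ht, ht0, hR⟩ := h
  have h1 := FlSubDot.abs_sub_le hu hu1 ht
  rw [Fin.card_Iio] at h1
  have hq := one_le_infl hu hu1
  have hs := Real.mul_self_sqrt ht0.le
  have hs0 := Real.sqrt_nonneg t
  have h2 : |√t * √t - R j j * R j j| ≤ (infl u ^ 2 - 1) * (|R j j| * |R j j|) := by
    have h3 := hR.abs_sub_le_right hu hu1
    have h4 : |R j j + √t| ≤ (infl u + 1) * |R j j| := by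
      have h5 := abs_add_le (√t - R j j) (2 * R j j)
      rw [abs_sub_comm, show √t - R j j + 2 * R j j = R j j + √t by ring, abs_mul,
        abs_two] at h5
      linarith
    have h6 := mul_le_mul h3 h4 (abs_nonneg _)
      (mul_nonneg (by linarith) (abs_nonneg _))
    rw [← abs_mul] at h6
    rw [abs_sub_comm, show R j j * R j j - √t * √t = (R j j - √t) * (R j j + √t) by ring]
    refine h6.trans (le_of_eq ?_)
    ring
  rw [hs] at h2
  have h3 : |t| ≤ infl u ^ 2 * (|R j j| * |R j j|) := by
    have := abs_add_le (t - R j j * R j j) (R j j * R j j)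
    rw [sub_add_cancel, abs_mul (R j j)] at this
    linarith
  have h4 := mul_le_mul_of_nonneg_left h3 (infl_pow_sub_one_nonneg hu hu1 j)
  have h5 : infl u ^ ((j : ℕ) + 2) ≤ infl u ^ (n + 1) := pow_le_pow_right₀ hq (by omega)
  have h5' : infl u ^ ((j : ℕ) + 1) ≤ infl u ^ (n + 1) := pow_le_pow_right₀ hq (by omega)
  have hS : 0 ≤ ∑ k ∈ Finset.Iio j, |R k j| * |R k j| :=
    Finset.sum_nonneg fun _ _ => mul_nonneg (abs_nonneg _) (abs_nonneg _)
  have h6 := abs_add_le (A j j - ∑ k ∈ Finset.Iio j, R k j * R k j - t) (t - R j j * R j j)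
  rw [sub_add_sub_cancel] at h6
  have h7 := mul_le_mul_of_nonneg_right h5 (mul_nonneg (abs_nonneg (R j j)) (abs_nonneg (R j j)))
  have h8 := mul_le_mul_of_nonneg_right h5' hS
  rw [pow_add] at h7
  rw [sum_Iic_eq, sum_Iic_eq, ← sub_sub]
  linarith

theorem CholPivot.le_of_nonpos {u : ℝ} (hu : 0 ≤ u) (hu1 : u < 1) {n : ℕ}
    {A R : Matrix (Fin n) (Fin n) ℝ} {j : Fin n} {t : ℝ} (h : CholPivot u A R j t) (ht : t ≤ 0)
    (hq2 : infl u ^ (n + 1) ≤ 2) :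
    A j j ≤ infl u ^ (n + 1) * ∑ k ∈ Finset.Iio j, R k j * R k j := by
  have h1 := FlSubDot.abs_sub_le hu hu1 h
  rw [Fin.card_Iio, abs_of_nonpos ht] at h1
  have hq := one_le_infl hu hu1
  have h5 : infl u ^ (j : ℕ) ≤ infl u ^ (n + 1) := pow_le_pow_right₀ hq (by omega)
  have h5' : infl u ^ ((j : ℕ) + 1) ≤ infl u ^ (n + 1) := pow_le_pow_right₀ hq (by omega)
  simp only [abs_mul_abs_self] at h1
  have hS : 0 ≤ ∑ k ∈ Finset.Iio j, R k j * R k j :=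
    Finset.sum_nonneg fun _ _ => mul_self_nonneg _
  have h6 := (abs_le.mp h1).2
  have h7 := mul_le_mul_of_nonneg_right h5' hS
  have h8 := mul_le_mul_of_nonneg_right (h5.trans hq2) (neg_nonneg.mpr ht)
  linarith

theorem FlTriSolve.abs_sub_le {u : ℝ} (hu : 0 ≤ u) (hu1 : u < 1) {m n : ℕ}
    {X Y : Matrix (Fin m) (Fin n) ℝ} {R : Matrix (Fin n) (Fin n) ℝ} (h : FlTriSolve u X R Y)
    (hR : ∀ i j, j < i → R i j = 0) (hd : ∀ j, R j j ≠ 0) (i : Fin m) (j : Fin n) :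
    |(Y * R - X) i j| ≤ (infl u ^ n - 1) * ∑ k, |Y i k| * |R k j| := by
  obtain ⟨t, ht, hy⟩ := h i j
  have h1 := ht.abs_sub_mul_le hu hu1 (hd j) hy
  have key : ∀ f : Fin n → ℝ, (∀ k, j < k → f k = 0) →
      ∑ k, f k = ∑ k ∈ Finset.Iio j, f k + f j := fun f hf => by
    rw [← sum_Iic_eq]
    refine (Finset.sum_subset (Finset.subset_univ _) fun k _ hk => hf k ?_).symm
    simpa using hk
  rw [Matrix.sub_apply, Matrix.mul_apply, key _ fun k hk => by rw [hR k j hk, mul_zero],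
    key (fun k => |Y i k| * |R k j|) fun k hk => by rw [hR k j hk, abs_zero, mul_zero],
    abs_sub_comm, ← sub_sub]
  exact h1

/-! ### Perturbation of Gram matrices -/

theorem vecNorm_mulVec_sq {m n : ℕ} (X : Matrix (Fin m) (Fin n) ℝ) (v : Fin n → ℝ) :
    vecNorm (X.mulVec v) ^ 2 = ∑ i, ∑ j, v i * v j * ∑ k, X k i * X k j := by
  have h1 : ∀ i j, v i * v j * ∑ k, X k i * X k j = ∑ k, X k i * v i * (X k j * v j) :=
    fun i j => by
      rw [Finset.mul_sum]
      exact Finset.sum_congr rfl fun k _ => by ring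
  simp only [h1]
  rw [vecNorm_sq]
  simp only [Matrix.mulVec, dotProduct, sq, Finset.sum_mul_sum]
  rw [Finset.sum_comm]
  exact Finset.sum_congr rfl fun i _ => Finset.sum_comm

theorem vecNorm_mulVec_sq_sub {m l n : ℕ} (X : Matrix (Fin m) (Fin n) ℝ)
    (T : Matrix (Fin l) (Fin n) ℝ) (v : Fin n → ℝ) :
    vecNorm (X.mulVec v) ^ 2 - vecNorm (T.mulVec v) ^ 2 =
      ∑ i, ∑ j, v i * v j * (∑ k, X k i * X k j - ∑ k, T k i * T k j) := by
  simp only [vecNorm_mulVec_sq, ← Finset.sum_sub_distrib, mul_sub]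

theorem sq_sum_colNorm_mul_le {m n : ℕ} (X : Matrix (Fin m) (Fin n) ℝ) (v : Fin n → ℝ) :
    (∑ i, colNorm X i * |v i|) ^ 2 ≤ frobNorm X ^ 2 * vecNorm v ^ 2 := by
  rw [← sum_colNorm_sq, ← vecNorm_abs v, vecNorm_sq]
  exact Finset.sum_mul_sq_le_sq_mul_sq Finset.univ (colNorm X) fun i => |v i|

theorem gram_sub_gram_le {u : ℝ} (hu : 0 ≤ u) (hu1 : u < 1) {m n : ℕ}
    {X : Matrix (Fin m) (Fin n) ℝ} {A R T : Matrix (Fin n) (Fin n) ℝ} {g : ℝ} (hg : 0 ≤ g)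
    (hA : FlMul u X.transpose X A) {i j : Fin n}
    (hR : |A i j - ∑ k ∈ Finset.Iic i, R k i * R k j| ≤
      g * ∑ k ∈ Finset.Iic i, |R k i| * |R k j|)
    (hTi : ∀ k, i < k → T k i = 0) (hTi' : ∀ k ≤ i, T k i = R k i)
    (hTj : ∀ k ≤ i, T k j = R k j) :
    |∑ k, X k i * X k j - ∑ k, T k i * T k j| ≤
      g * (colNorm T i * colNorm T j) + (infl u ^ m - 1) * (colNorm X i * colNorm X j) := by
  have h1 : ∑ k, T k i * T k j = ∑ k ∈ Finset.Iic i, R k i * R k j := by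
    rw [← Finset.sum_subset (Finset.subset_univ (Finset.Iic i)) fun k _ hk => by
      rw [hTi k (by simpa using hk), zero_mul]]
    refine Finset.sum_congr rfl fun k hk => ?_
    rw [hTi' k (Finset.mem_Iic.mp hk), hTj k (Finset.mem_Iic.mp hk)]
  have h2 : ∑ k, |T k i| * |T k j| = ∑ k ∈ Finset.Iic i, |R k i| * |R k j| := by
    rw [← Finset.sum_subset (Finset.subset_univ (Finset.Iic i)) fun k _ hk => by
      rw [hTi k (by simpa using hk), abs_zero, zero_mul]]
    refine Finset.sum_congr rfl fun k hk => ?_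
    rw [hTi' k (Finset.mem_Iic.mp hk), hTj k (Finset.mem_Iic.mp hk)]
  rw [← h1, ← h2] at hR
  have h3 := hR.trans (mul_le_mul_of_nonneg_left
    (sum_abs_mul_abs_le (fun k => T k i) fun k => T k j) hg)
  have h4 := hA.gram_abs_sub_le hu hu1 i j
  have h5 := abs_sub_le (∑ k, X k i * X k j) (A i j) (∑ k, T k i * T k j)
  rw [abs_sub_comm _ (A i j)] at h5
  unfold colNorm at h4 ⊢
  linarith

/-! ### CholeskyQR applied to a well-conditioned matrix -/

/-- The singular values of `X` lie between `σ` and `M`, and the unit roundoff `u` is small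
compared to `(σ / M)²`. -/
structure WellConditioned (u : ℝ) {m n : ℕ} (X : Matrix (Fin m) (Fin n) ℝ) (σ M : ℝ) : Prop where
  nonneg : 0 ≤ u
  pos : 0 < n
  le : n ≤ m
  sigma_pos : 0 < σ
  sigma_le : σ ≤ M
  lower : ∀ v, σ * vecNorm v ≤ vecNorm (X.mulVec v)
  upper : ∀ v, vecNorm (X.mulVec v) ≤ M * vecNorm v
  small : 50 * ((m : ℝ) * n * u + (n : ℝ) * (n + 1) * u) * M ^ 2 ≤ σ ^ 2

theorem frobNorm_sq_le {m n : ℕ} {X : Matrix (Fin m) (Fin n) ℝ} {M : ℝ}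
    (h : ∀ v, vecNorm (X.mulVec v) ≤ M * vecNorm v) : frobNorm X ^ 2 ≤ n * M ^ 2 := by
  rw [← sum_colNorm_sq]
  calc ∑ j, colNorm X j ^ 2 ≤ ∑ _j : Fin n, M ^ 2 := Finset.sum_le_sum fun j _ => by
        refine pow_le_pow_left₀ (colNorm_nonneg _ _) ?_ 2
        rw [colNorm_eq_vecNorm_mulVec]
        simpa [vecNorm_single] using h (Pi.single j 1)
    _ = n * M ^ 2 := by simp

namespace WellConditioned

variable {u σ M : ℝ} {m n : ℕ} {X : Matrix (Fin m) (Fin n) ℝ}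

theorem mul_le (h : WellConditioned u X σ M) : ((m : ℝ) + (n + 1)) * n * u ≤ 1 / 50 := by
  have hM : 0 < M := h.sigma_pos.trans_le h.sigma_le
  have h1 : σ ^ 2 ≤ M ^ 2 := pow_le_pow_left₀ h.sigma_pos.le h.sigma_le 2
  have h2 := h.small.trans h1
  have h3 : 50 * ((m : ℝ) * n * u + (n : ℝ) * (n + 1) * u) ≤ 1 :=
    le_of_mul_le_mul_right (by linarith) (pow_pos hM 2)
  linarith

theorem add_mul_le (h : WellConditioned u X σ M) : ((m : ℝ) + (n + 1)) * u ≤ 1 / 50 := by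
  have hn : (1 : ℝ) ≤ n := by exact_mod_cast h.pos
  have h1 := h.mul_le
  have h2 : 0 ≤ ((m : ℝ) + (n + 1)) * u := mul_nonneg (by positivity) h.nonneg
  nlinarith

theorem lt_one (h : WellConditioned u X σ M) : u < 1 := by
  have h1 := h.add_mul_le
  have h2 : 0 ≤ ((m : ℝ) + n) * u := mul_nonneg (by positivity) h.nonneg
  linarith

theorem infl_pow_sub_one_le (h : WellConditioned u X σ M) {k : ℕ} (hk : k ≤ m + (n + 1)) :
    infl u ^ k - 1 ≤ 50 / 49 * (k * u) := by
  have hk' : (k : ℝ) ≤ m + (n + 1) := by exact_mod_cast hk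
  have h1 := (mul_le_mul_of_nonneg_right hk' h.nonneg).trans h.add_mul_le
  have h2 : 0 ≤ k * u := mul_nonneg k.cast_nonneg h.nonneg
  refine (FloatQR.infl_pow_sub_one_le h.lt_one k (by linarith)).trans ?_
  rw [div_le_iff₀ (by linarith)]
  nlinarith

theorem infl_add_le (h : WellConditioned u X σ M) :
    (infl u ^ m - 1) + (infl u ^ (n + 1) - 1) ≤ 50 / 49 * (((m : ℝ) + (n + 1)) * u) := by
  have h1 := h.infl_pow_sub_one_le (k := m) (by omega)
  have h2 := h.infl_pow_sub_one_le (k := n + 1) (by omega)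
  push_cast at h2
  linarith

theorem infl_add_le' (h : WellConditioned u X σ M) :
    (infl u ^ m - 1) + (infl u ^ (n + 1) - 1) ≤ 1 / 49 := by
  linarith [h.infl_add_le, h.add_mul_le]

theorem infl_add_mul_le (h : WellConditioned u X σ M) :
    ((infl u ^ m - 1) + (infl u ^ (n + 1) - 1)) * frobNorm X ^ 2 ≤ σ ^ 2 / 49 := by
  have hG : 0 ≤ (infl u ^ m - 1) + (infl u ^ (n + 1) - 1) :=
    add_nonneg (infl_pow_sub_one_nonneg h.nonneg h.lt_one _)
      (infl_pow_sub_one_nonneg h.nonneg h.lt_one _)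
  have h1 := mul_le_mul_of_nonneg_left (frobNorm_sq_le h.upper) hG
  have h2 := mul_le_mul_of_nonneg_right h.infl_add_le
    (mul_nonneg n.cast_nonneg (sq_nonneg M) : 0 ≤ (n : ℝ) * M ^ 2)
  linarith [h.small]

theorem colNorm_sq_le (h : WellConditioned u X σ M) {A R T : Matrix (Fin n) (Fin n) ℝ}
    (hA : FlMul u X.transpose X A) {j : Fin n} (hd : CholDiag u A R j)
    (hT : ∀ k, j < k → T k j = 0) (hT' : ∀ k ≤ j, T k j = R k j) :
    colNorm T j ^ 2 ≤ 1.1 * colNorm X j ^ 2 := by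
  have h1 := hd.abs_sub_le h.nonneg h.lt_one
  have h2 : ∑ k ∈ Finset.Iic j, R k j * R k j = colNorm T j ^ 2 := by
    rw [colNorm_sq, ← Finset.sum_subset (Finset.subset_univ (Finset.Iic j)) fun k _ hk => by
      rw [hT k (by simpa using hk), zero_mul]]
    refine Finset.sum_congr rfl fun k hk => ?_
    rw [hT' k (Finset.mem_Iic.mp hk)]
  simp only [abs_mul_abs_self] at h1
  rw [h2] at h1
  have h3 := hA.gram_abs_sub_le h.nonneg h.lt_one j j
  rw [← colNorm_sq, ← sq] at h3
  have hm := infl_pow_sub_one_nonneg h.nonneg h.lt_one m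
  have hn := infl_pow_sub_one_nonneg h.nonneg h.lt_one (n + 1)
  have hG := h.infl_add_le'
  have h4 := (abs_le.mp h1).1
  have h5 := (abs_le.mp h3).2
  have hT0 := sq_nonneg (colNorm T j)
  have hX0 := sq_nonneg (colNorm X j)
  have h6 := mul_le_mul_of_nonneg_right (show infl u ^ (n + 1) - 1 ≤ 1 / 49 by linarith) hT0
  have h7 := mul_le_mul_of_nonneg_right (show infl u ^ m - 1 ≤ 1 / 49 by linarith) hX0
  linarith

theorem abs_sq_sub_sq_le (h : WellConditioned u X σ M) {A R : Matrix (Fin n) (Fin n) ℝ}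
    (hA : FlMul u X.transpose X A) (hR : FlChol u A R) (v : Fin n → ℝ) :
    |vecNorm (X.mulVec v) ^ 2 - vecNorm (R.mulVec v) ^ 2| ≤ vecNorm (X.mulVec v) ^ 2 / 40 := by
  have hm := infl_pow_sub_one_nonneg h.nonneg h.lt_one m
  have hn := infl_pow_sub_one_nonneg h.nonneg h.lt_one (n + 1)
  obtain ⟨hR0, hRe, hRd⟩ := hR
  have hcol : ∀ j, colNorm R j ^ 2 ≤ 1.1 * colNorm X j ^ 2 := fun j =>
    h.colNorm_sq_le hA (hRd j) (fun k hk => hR0 k j hk) fun _ _ => rfl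
  have hcol2 : ∀ i j, colNorm R i * colNorm R j ≤ 1.1 * (colNorm X i * colNorm X j) :=
    fun i j => by
      have hX := mul_nonneg (colNorm_nonneg X i) (colNorm_nonneg X j)
      refine le_of_sq_le_sq ?_ (by linarith)
      have := mul_le_mul (hcol i) (hcol j) (sq_nonneg _) (by positivity)
      linarith
  set c : ℝ := 1.1 * ((infl u ^ m - 1) + (infl u ^ (n + 1) - 1)) with hc
  have key : ∀ i j, i ≤ j →
      |∑ k, X k i * X k j - ∑ k, R k i * R k j| ≤ c * (colNorm X i * colNorm X j) := by
    intro i j hij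
    have h1 : |A i j - ∑ k ∈ Finset.Iic i, R k i * R k j| ≤
        (infl u ^ (n + 1) - 1) * ∑ k ∈ Finset.Iic i, |R k i| * |R k j| := by
      rcases hij.eq_or_lt with rfl | hlt
      · exact (hRd i).abs_sub_le h.nonneg h.lt_one
      · exact (hRe i j hlt).abs_sub_le h.nonneg h.lt_one (hRd i)
    have h2 := gram_sub_gram_le h.nonneg h.lt_one hn hA h1 (fun k hk => hR0 k i hk)
      (fun _ _ => rfl) fun _ _ => rfl
    have h3 := mul_le_mul_of_nonneg_left (hcol2 i j) hn
    have h4 := mul_nonneg hm (mul_nonneg (colNorm_nonneg X i) (colNorm_nonneg X j))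
    rw [hc]
    linarith
  have key' : ∀ i j,
      |∑ k, X k i * X k j - ∑ k, R k i * R k j| ≤ c * (colNorm X i * colNorm X j) := by
    intro i j
    rcases le_total i j with hij | hij
    · exact key i j hij
    · have := key j i hij
      simpa only [mul_comm] using this
  have h1 : |vecNorm (X.mulVec v) ^ 2 - vecNorm (R.mulVec v) ^ 2| ≤
      c * (∑ i, colNorm X i * |v i|) ^ 2 := by
    rw [vecNorm_mulVec_sq_sub, sq, Finset.sum_mul_sum, Finset.mul_sum]
    refine (Finset.abs_sum_le_sum_abs _ _).trans (Finset.sum_le_sum fun i _ => ?_)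
    rw [Finset.mul_sum]
    refine (Finset.abs_sum_le_sum_abs _ _).trans (Finset.sum_le_sum fun j _ => ?_)
    rw [abs_mul, abs_mul]
    have := mul_le_mul_of_nonneg_left (key' i j) (mul_nonneg (abs_nonneg (v i)) (abs_nonneg (v j)))
    linarith
  have hc0 : 0 ≤ c := by rw [hc]; linarith
  have h2 := mul_le_mul_of_nonneg_left (sq_sum_colNorm_mul_le X v) hc0
  have h3 := mul_le_mul_of_nonneg_right h.infl_add_mul_le (sq_nonneg (vecNorm v))
  have h4 : σ ^ 2 * vecNorm v ^ 2 ≤ vecNorm (X.mulVec v) ^ 2 := by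
    rw [← mul_pow]
    exact pow_le_pow_left₀ (mul_nonneg h.sigma_pos.le (vecNorm_nonneg v)) (h.lower v) 2
  have h5 := sq_nonneg (vecNorm (X.mulVec v))
  rw [hc] at h1 h2
  linarith

theorem not_breaksDown (h : WellConditioned u X σ M) : ¬ CholeskyQRBreaksDown u X := by
  rintro ⟨A, hA, R, p, t, hRe, hRd, hp, ht⟩
  have hm := infl_pow_sub_one_nonneg h.nonneg h.lt_one m
  have hn := infl_pow_sub_one_nonneg h.nonneg h.lt_one (n + 1)
  have hG := h.infl_add_le'
  set T : Matrix (Fin n) (Fin n) ℝ := fun k j =>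
    if j < p then (if k ≤ j then R k j else 0)
    else if j = p then (if k < p then R k p else 0) else (if k = j then 1 else 0) with hT
  have hT0 : ∀ k j, j < k → T k j = 0 := fun k j hkj => by
    simp only [hT]
    split_ifs <;> first | rfl | omega
  have hTlt : ∀ k j, j < p → k ≤ j → T k j = R k j := fun k j h1 h2 => by
    simp only [hT, if_pos h1, if_pos h2]
  have hTp : ∀ k, k < p → T k p = R k p := fun k h1 => by simp [hT, h1]
  have hTp0 : ∀ k, ¬ k < p → T k p = 0 := fun k h1 => by simp [hT, h1]
  have hdet : T.det = 0 := by
    rw [Matrix.det_of_isUpperTriangular fun i j hij => hT0 i j hij]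
    exact Finset.prod_eq_zero (Finset.mem_univ p) (hTp0 p (lt_irrefl p))
  obtain ⟨v, hv, hTv⟩ := Matrix.exists_mulVec_eq_zero_iff.mpr hdet
  have hvp : ∀ k, p < k → v k = 0 := fun k hk => by
    have h1 := congrFun hTv k
    rw [Matrix.mulVec, dotProduct, Finset.sum_eq_single k] at h1
    · simpa [hT, hk.ne', hk.not_gt] using h1
    · intro j _ hj
      have : T k j = 0 := by
        simp only [hT]
        split_ifs <;> first | rfl | omega
      rw [this, zero_mul]
    · simp
  have hcol : ∀ i, i < p → colNorm T i ≤ 1.1 * colNorm X i := fun i hi => by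
    have h1 := h.colNorm_sq_le hA (hRd i hi) (fun k hk => hT0 k i hk) fun k hk => hTlt k i hi hk
    have h2 := colNorm_nonneg X i
    refine le_of_sq_le_sq ?_ (by linarith)
    nlinarith
  have hN : colNorm T p ^ 2 = ∑ k ∈ Finset.Iio p, R k p * R k p := by
    rw [colNorm_sq, ← Finset.sum_subset (Finset.subset_univ (Finset.Iio p)) fun k _ hk => by
      rw [hTp0 k (by simpa using hk), zero_mul]]
    refine Finset.sum_congr rfl fun k hk => ?_
    rw [hTp k (Finset.mem_Iio.mp hk)]
  have hpiv : (1 - (infl u ^ m - 1)) * colNorm X p ^ 2 ≤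
      infl u ^ (n + 1) * colNorm T p ^ 2 := by
    have h1 := hp.le_of_nonpos h.nonneg h.lt_one ht (by linarith)
    have h2 := hA.gram_abs_sub_le h.nonneg h.lt_one p p
    rw [← colNorm_sq, ← sq] at h2
    rw [← hN] at h1
    linarith [(abs_le.mp h2).1]
  set a := infl u ^ m - 1 with ha
  set b := infl u ^ (n + 1) - 1 with hb
  have key : ∀ i j, i ≤ j → j ≤ p → i < p → |∑ k, X k i * X k j - ∑ k, T k i * T k j| ≤
      b * (colNorm T i * colNorm T j) + a * (colNorm X i * colNorm X j) := by
    intro i j hij hjp hip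
    have h1 : |A i j - ∑ k ∈ Finset.Iic i, R k i * R k j| ≤
        (infl u ^ (n + 1) - 1) * ∑ k ∈ Finset.Iic i, |R k i| * |R k j| := by
      rcases hij.eq_or_lt with rfl | hlt
      · exact (hRd i hip).abs_sub_le h.nonneg h.lt_one
      · exact (hRe i j hlt hjp).abs_sub_le h.nonneg h.lt_one (hRd i hip)
    refine gram_sub_gram_le h.nonneg h.lt_one hn hA h1 (fun k hk => hT0 k i hk)
      (fun k hk => hTlt k i hip hk) fun k hk => ?_
    rcases hjp.eq_or_lt with rfl | hlt
    · exact hTp k (hk.trans_lt hip)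
    · exact hTlt k j hlt (hk.trans hij)
  have hterm : ∀ i j, v i * v j * (∑ k, X k i * X k j - ∑ k, T k i * T k j) ≤
      b * (colNorm T i * |v i| * (colNorm T j * |v j|)) +
        a * (colNorm X i * |v i| * (colNorm X j * |v j|)) +
        (if i = p then if j = p then v p ^ 2 * (colNorm X p ^ 2 - colNorm T p ^ 2) else 0
          else 0) := by
    have hnn : ∀ i j, 0 ≤ b * (colNorm T i * |v i| * (colNorm T j * |v j|)) +
        a * (colNorm X i * |v i| * (colNorm X j * |v j|)) := fun i j => by
      have h1 := colNorm_nonneg T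
      have h2 := colNorm_nonneg X
      exact add_nonneg
        (mul_nonneg hn (mul_nonneg (mul_nonneg (h1 i) (abs_nonneg _))
          (mul_nonneg (h1 j) (abs_nonneg _))))
        (mul_nonneg hm (mul_nonneg (mul_nonneg (h2 i) (abs_nonneg _))
          (mul_nonneg (h2 j) (abs_nonneg _))))
    intro i j
    by_cases hip : p < i
    · rw [hvp i hip, if_neg hip.ne']
      simp
    by_cases hjp : p < j
    · rw [hvp j hjp, if_neg hjp.ne']
      simp
    by_cases hpp : i = p ∧ j = p
    · rw [hpp.1, hpp.2, if_pos rfl, if_pos rfl, ← colNorm_sq, ← colNorm_sq]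
      linarith [hnn p p, sq (v p)]
    have hz : (if i = p then if j = p then v p ^ 2 * (colNorm X p ^ 2 - colNorm T p ^ 2) else 0
          else 0) = 0 := by
      split_ifs with h1 h2
      · exact absurd ⟨h1, h2⟩ hpp
      · rfl
      · rfl
    rw [hz, add_zero]
    have hle : |∑ k, X k i * X k j - ∑ k, T k i * T k j| ≤
      b * (colNorm T i * colNorm T j) + a * (colNorm X i * colNorm X j) := by
      rcases le_total i j with hij | hij
      · exact key i j hij (not_lt.mp hjp) (by omega)
      · have := key j i hij (not_lt.mp hip) (by omega)
        simpa only [mul_comm] using this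
    refine (le_abs_self _).trans ?_
    rw [abs_mul, abs_mul]
    have := mul_le_mul_of_nonneg_left hle (mul_nonneg (abs_nonneg (v i)) (abs_nonneg (v j)))
    linarith
  set S := ∑ i, colNorm X i * |v i| with hS
  have hsum : vecNorm (X.mulVec v) ^ 2 ≤ b * (∑ i, colNorm T i * |v i|) ^ 2 + a * S ^ 2 +
      v p ^ 2 * (colNorm X p ^ 2 - colNorm T p ^ 2) := by
    have h1 := vecNorm_mulVec_sq_sub X T v
    have h0 : vecNorm (T.mulVec v) ^ 2 = 0 := by rw [hTv]; simp [vecNorm]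
    rw [h0, sub_zero] at h1
    rw [h1]
    refine (Finset.sum_le_sum fun i _ => Finset.sum_le_sum fun j _ => hterm i j).trans
      (le_of_eq ?_)
    simp only [Finset.sum_add_distrib, ← Finset.mul_sum, sq, hS, Finset.sum_mul_sum]
    simp
  have hnnS : ∀ i, 0 ≤ colNorm X i * |v i| := fun i =>
    mul_nonneg (colNorm_nonneg X i) (abs_nonneg _)
  have hS0 : 0 ≤ S := Finset.sum_nonneg fun i _ => hnnS i
  have hpS : colNorm X p * |v p| ≤ S :=
    Finset.single_le_sum (fun i _ => hnnS i) (Finset.mem_univ p)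
  have hTS : ∑ i, colNorm T i * |v i| ≤ 1.1 * S + colNorm T p * |v p| := by
    rw [← Finset.add_sum_erase _ _ (Finset.mem_univ p), add_comm, hS, Finset.mul_sum]
    refine add_le_add_left ?_ _
    refine (Finset.sum_le_sum fun i hi => ?_).trans
      (Finset.sum_le_sum_of_subset_of_nonneg (Finset.erase_subset p Finset.univ)
        fun i _ _ => mul_nonneg (by norm_num) (hnnS i))
    rcases lt_or_gt_of_ne (Finset.ne_of_mem_erase hi) with hlt | hgt
    · have := mul_le_mul_of_nonneg_right (hcol i hlt) (abs_nonneg (v i))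
      linarith
    · simp [hvp i hgt]
  have hT0' : 0 ≤ ∑ i, colNorm T i * |v i| :=
    Finset.sum_nonneg fun i _ => mul_nonneg (colNorm_nonneg T i) (abs_nonneg _)
  have hTS2 : (∑ i, colNorm T i * |v i|) ^ 2 ≤ 2.42 * S ^ 2 + 2 * (colNorm T p ^ 2 * v p ^ 2) := by
    have h1 := pow_le_pow_left₀ hT0' hTS 2
    have h2 := sq_nonneg (1.1 * S - colNorm T p * |v p|)
    have h3 : (colNorm T p * |v p|) ^ 2 = colNorm T p ^ 2 * v p ^ 2 := by rw [mul_pow, sq_abs]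
    nlinarith
  have hpS2 : colNorm X p ^ 2 * v p ^ 2 ≤ S ^ 2 := by
    rw [← sq_abs (v p), ← mul_pow]
    exact pow_le_pow_left₀ (hnnS p) hpS 2
  have hscal : colNorm X p ^ 2 - colNorm T p ^ 2 + 2 * b * colNorm T p ^ 2 ≤
      6 * (a + b) * colNorm X p ^ 2 := by
    have hb' : infl u ^ (n + 1) = 1 + b := by rw [hb]; ring
    rw [hb'] at hpiv
    have h1 := sq_nonneg (colNorm X p)
    have h2 := mul_nonneg hm h1
    have h3 := mul_nonneg hn h1
    have h5 := mul_nonneg hn (sq_nonneg (colNorm T p))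
    rcases le_total (colNorm T p ^ 2) (2 * colNorm X p ^ 2) with hle | hle
    · have h4 := mul_le_mul_of_nonneg_left hle hn
      linarith
    · have h4 := mul_le_mul_of_nonneg_right (show b ≤ 1 / 49 by linarith)
        (sq_nonneg (colNorm T p))
      linarith
  have h1 := mul_le_mul_of_nonneg_left hTS2 hn
  have h2 := mul_le_mul_of_nonneg_right hscal (sq_nonneg (v p))
  have h3 := mul_le_mul_of_nonneg_left hpS2 (add_nonneg hm hn)
  have h4 := mul_le_mul_of_nonneg_left (sq_sum_colNorm_mul_le X v) (add_nonneg hm hn)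
  have h5 := mul_le_mul_of_nonneg_right h.infl_add_mul_le (sq_nonneg (vecNorm v))
  have h6 : σ ^ 2 * vecNorm v ^ 2 ≤ vecNorm (X.mulVec v) ^ 2 := by
    rw [← mul_pow]
    exact pow_le_pow_left₀ (mul_nonneg h.sigma_pos.le (vecNorm_nonneg v)) (h.lower v) 2
  have h7 : 0 < σ ^ 2 * vecNorm v ^ 2 :=
    mul_pos (pow_pos h.sigma_pos 2) (pow_pos (vecNorm_pos hv) 2)
  have h8 := mul_nonneg hm (sq_nonneg S)
  have h9 := mul_nonneg hn (sq_nonneg S)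
  linarith

end WellConditioned

theorem FlChol.det_ne_zero {u : ℝ} (hu1 : u < 1) {n : ℕ} {A R : Matrix (Fin n) (Fin n) ℝ}
    (h : FlChol u A R) : R.det ≠ 0 := by
  rw [Matrix.det_of_isUpperTriangular fun i j hij => h.1 i j hij]
  exact Finset.prod_ne_zero_iff.mpr fun j _ => ((h.2.2 j).pos hu1).ne'

namespace WellConditioned

variable {u σ M : ℝ} {m n : ℕ} {X : Matrix (Fin m) (Fin n) ℝ}

theorem infl_mul_le (h : WellConditioned u X σ M) : (infl u ^ n - 1) * (n * M) ≤ σ / 98 := by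
  have hM : 0 < M := h.sigma_pos.trans_le h.sigma_le
  have h1 := h.infl_pow_sub_one_le (k := n) (by omega)
  have hmn : (n : ℝ) ≤ m := by exact_mod_cast h.le
  have hn0 : (0 : ℝ) ≤ n := n.cast_nonneg
  have h2 : (n : ℝ) * n * u * M ^ 2 ≤ (m : ℝ) * n * u * M ^ 2 := by
    have := mul_nonneg (mul_nonneg hn0 h.nonneg) (sq_nonneg M)
    nlinarith
  have h3 : 0 ≤ (n : ℝ) * u * M ^ 2 := mul_nonneg (mul_nonneg hn0 h.nonneg) (sq_nonneg M)
  have h4 : (n : ℝ) * n * u * M ^ 2 ≤ σ ^ 2 / 100 := by linarith [h.small]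
  have h5 : σ ^ 2 ≤ σ * M := by
    rw [sq]; exact mul_le_mul_of_nonneg_left h.sigma_le h.sigma_pos.le
  have h6 : (n : ℝ) * n * u * M ≤ σ / 100 := by
    refine le_of_mul_le_mul_right ?_ hM
    linarith
  have h7 := mul_le_mul_of_nonneg_right h1 (mul_nonneg hn0 hM.le)
  linarith

theorem vecNorm_mulVec_R_le (h : WellConditioned u X σ M) {A R : Matrix (Fin n) (Fin n) ℝ}
    (hA : FlMul u X.transpose X A) (hR : FlChol u A R) (v : Fin n → ℝ) :
    vecNorm (R.mulVec v) ≤ 1.013 * M * vecNorm v := by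
  have h1 := (abs_le.mp (h.abs_sq_sub_sq_le hA hR v)).1
  have h2 := pow_le_pow_left₀ (vecNorm_nonneg _) (h.upper v) 2
  have hM : 0 < M := h.sigma_pos.trans_le h.sigma_le
  have hv := vecNorm_nonneg v
  refine le_of_sq_le_sq ?_ (by positivity)
  have h3 := sq_nonneg (M * vecNorm v)
  linarith

theorem frobNorm_R_le (h : WellConditioned u X σ M) {A R : Matrix (Fin n) (Fin n) ℝ}
    (hA : FlMul u X.transpose X A) (hR : FlChol u A R) : frobNorm R ≤ 1.013 * M * √n := by
  have hM : 0 < M := h.sigma_pos.trans_le h.sigma_le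
  refine le_of_sq_le_sq ?_ (by positivity)
  refine (frobNorm_sq_le (h.vecNorm_mulVec_R_le hA hR)).trans (le_of_eq ?_)
  rw [mul_pow _ √(n : ℝ), Real.sq_sqrt n.cast_nonneg, mul_comm]

theorem residual_le (h : WellConditioned u X σ M) {A R : Matrix (Fin n) (Fin n) ℝ}
    {Q : Matrix (Fin m) (Fin n) ℝ} (hR : FlChol u A R) (hQ : FlTriSolve u X R Q) :
    frobNorm (Q * R - X) ≤ (infl u ^ n - 1) * (frobNorm Q * frobNorm R) :=
  frobNorm_le_of_abs_le (infl_pow_sub_one_nonneg h.nonneg h.lt_one n)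
    (hQ.abs_sub_le h.nonneg h.lt_one hR.1 fun j => ((hR.2.2 j).pos h.lt_one).ne')

theorem exists_preimage (h : WellConditioned u X σ M) {A R : Matrix (Fin n) (Fin n) ℝ}
    {Q : Matrix (Fin m) (Fin n) ℝ} (hA : FlMul u X.transpose X A) (hR : FlChol u A R)
    (hQ : FlTriSolve u X R Q) (v : Fin n → ℝ) :
    ∃ x, |vecNorm (Q.mulVec v) - x| ≤ 0.01034 * (frobNorm Q / √n) * x ∧
      0.987 * vecNorm v ≤ x ∧ x ≤ 1.0128 * vecNorm v := by
  have hdet := hR.det_ne_zero h.lt_one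
  obtain ⟨w, rfl⟩ : ∃ w, R.mulVec w = v :=
    ⟨R⁻¹.mulVec v, by
      rw [Matrix.mulVec_mulVec, Matrix.mul_nonsing_inv _ (isUnit_iff_ne_zero.mpr hdet),
        Matrix.one_mulVec]⟩
  have hM : 0 < M := h.sigma_pos.trans_le h.sigma_le
  have hx := vecNorm_nonneg (X.mulVec w)
  have hv := vecNorm_nonneg (R.mulVec w)
  have h1 := abs_le.mp (h.abs_sq_sub_sq_le hA hR w)
  refine ⟨vecNorm (X.mulVec w), ?_, ?_, ?_⟩
  · have hn : (0 : ℝ) < n := by exact_mod_cast h.pos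
    have hs : 0 < √(n : ℝ) := Real.sqrt_pos.mpr hn
    have hss := Real.mul_self_sqrt hn.le
    have h2 : Q.mulVec (R.mulVec w) = X.mulVec w + (Q * R - X).mulVec w := by
      rw [Matrix.sub_mulVec, Matrix.mulVec_mulVec, add_sub_cancel]
    have h3 : |vecNorm (Q.mulVec (R.mulVec w)) - vecNorm (X.mulVec w)| ≤
        vecNorm ((Q * R - X).mulVec w) := by
      rw [abs_le]
      constructor
      · have := vecNorm_sub_le (Q.mulVec (R.mulVec w)) ((Q * R - X).mulVec w)
        rw [h2, add_sub_cancel_right, ← h2] at this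
        linarith
      · have := vecNorm_add_le (X.mulVec w) ((Q * R - X).mulVec w)
        rw [← h2] at this
        linarith
    have hg := infl_pow_sub_one_nonneg h.nonneg h.lt_one n
    have hφ := frobNorm_nonneg Q
    have h4 : frobNorm (Q * R - X) ≤ 0.01034 * (frobNorm Q / √n) * σ := by
      have h5 := mul_le_mul_of_nonneg_left
        (mul_le_mul_of_nonneg_left (h.frobNorm_R_le hA hR) hφ) hg
      have h6 : (infl u ^ n - 1) * (frobNorm Q * (1.013 * M * √n)) =
          1.013 * (frobNorm Q / √n) * ((infl u ^ n - 1) * (n * M)) := by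
        field_simp
        rw [Real.sq_sqrt hn.le]
      have h7 := mul_le_mul_of_nonneg_left h.infl_mul_le
        (by positivity : 0 ≤ 1.013 * (frobNorm Q / √n))
      have h8 : 0 ≤ frobNorm Q / √n * σ := mul_nonneg (by positivity) h.sigma_pos.le
      linarith [h.residual_le hR hQ]
    have h5 := (vecNorm_mulVec_le_frobNorm (Q * R - X) w).trans
      (mul_le_mul_of_nonneg_right h4 (vecNorm_nonneg w))
    have h6 := mul_le_mul_of_nonneg_left (h.lower w)
      (by positivity : 0 ≤ 0.01034 * (frobNorm Q / √n))
    linarith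
  · refine le_of_sq_le_sq ?_ hx
    rw [mul_pow]
    nlinarith [sq_nonneg (vecNorm (R.mulVec w))]
  · refine le_of_sq_le_sq ?_ (by positivity)
    rw [mul_pow]
    nlinarith [sq_nonneg (vecNorm (R.mulVec w))]

theorem frobNorm_Q_le (h : WellConditioned u X σ M) {A R : Matrix (Fin n) (Fin n) ℝ}
    {Q : Matrix (Fin m) (Fin n) ℝ} (hA : FlMul u X.transpose X A) (hR : FlChol u A R)
    (hQ : FlTriSolve u X R Q) : frobNorm Q ≤ 1.03 * √n := by
  have hn : (0 : ℝ) < n := by exact_mod_cast h.pos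
  have hs : 0 < √(n : ℝ) := Real.sqrt_pos.mpr hn
  have hφ := frobNorm_nonneg Q
  set c := frobNorm Q / √n with hc
  have hc0 : 0 ≤ c := by positivity
  have hQc : frobNorm Q = c * √n := by rw [hc]; field_simp
  have h1 : ∀ v, vecNorm (Q.mulVec v) ≤ (1.0128 * (1 + 0.01034 * c)) * vecNorm v := fun v => by
    obtain ⟨x, hx, _, hx2⟩ := h.exists_preimage hA hR hQ v
    have h2 := (abs_le.mp hx).2
    have h3 := mul_le_mul_of_nonneg_left hx2 (by positivity : 0 ≤ 1 + 0.01034 * c)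
    linarith
  have h2 := frobNorm_sq_le h1
  have h3 : frobNorm Q ≤ 1.0128 * (1 + 0.01034 * c) * √n := by
    refine le_of_sq_le_sq (h2.trans (le_of_eq ?_)) (by positivity)
    rw [mul_pow _ √(n : ℝ), Real.sq_sqrt hn.le, mul_comm]
  rw [hQc] at h3 ⊢
  have h4 := le_of_mul_le_mul_right h3 hs
  exact mul_le_mul_of_nonneg_right (by linarith) hs.le

theorem vecNorm_mulVec_Q (h : WellConditioned u X σ M) {A R : Matrix (Fin n) (Fin n) ℝ}
    {Q : Matrix (Fin m) (Fin n) ℝ} (hA : FlMul u X.transpose X A) (hR : FlChol u A R)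
    (hQ : FlTriSolve u X R Q) (v : Fin n → ℝ) :
    0.97 * vecNorm v ≤ vecNorm (Q.mulVec v) ∧ vecNorm (Q.mulVec v) ≤ 1.03 * vecNorm v := by
  have hn : (0 : ℝ) < n := by exact_mod_cast h.pos
  have hs : 0 < √(n : ℝ) := Real.sqrt_pos.mpr hn
  obtain ⟨x, hx, hx1, hx2⟩ := h.exists_preimage hA hR hQ v
  have hv := vecNorm_nonneg v
  have h1 : frobNorm Q / √n ≤ 1.03 := (div_le_iff₀ hs).mpr (h.frobNorm_Q_le hA hR hQ)
  have h2 := mul_le_mul_of_nonneg_right h1 (by linarith : 0 ≤ x)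
  have h3 := abs_le.mp hx
  constructor <;> linarith

end WellConditioned

theorem frobNorm_choleskyQR2_residual_le {u σ M : ℝ} {m n : ℕ} {X Z : Matrix (Fin m) (Fin n) ℝ}
    {U : Matrix (Fin n) (Fin n) ℝ} (h : WellConditioned u X σ M)
    (hstep : ∀ Y R, CholeskyQR u X Y R → WellConditioned u Y 0.97 1.03)
    (hZ : CholeskyQR2 u X Z U) : frobNorm (Z * U - X) ≤ 5 * (n : ℝ) ^ 2 * u * M := by
  obtain ⟨Y, R, S, hYR, ⟨C, hC, hS, hZS⟩, hU⟩ := hZ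
  have h' := hstep Y R hYR
  obtain ⟨A, hA, hR, hY⟩ := hYR
  have hM : 0 < M := h.sigma_pos.trans_le h.sigma_le
  have hn : (0 : ℝ) ≤ n := n.cast_nonneg
  have hs := Real.sqrt_nonneg (n : ℝ)
  have hss := Real.mul_self_sqrt hn
  set g := infl u ^ n - 1 with hg
  have hg0 : 0 ≤ g := infl_pow_sub_one_nonneg h.nonneg h.lt_one n
  have hgn : g ≤ 50 / 49 * (n * u) := h.infl_pow_sub_one_le (by omega)
  have hE : frobNorm (U - S * R) ≤ g * (frobNorm S * frobNorm R) :=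
    frobNorm_le_of_abs_le hg0 fun i j => by
      rw [Matrix.sub_apply, Matrix.mul_apply]
      exact (hU i j).abs_sub_le h.nonneg h.lt_one
  have hRF := h.frobNorm_R_le hA hR
  have hSF := h'.frobNorm_R_le hC hS
  have hYF := h.frobNorm_Q_le hA hR hY
  have hZF := h'.frobNorm_Q_le hC hS hZS
  have e1 : frobNorm ((Z * S - Y) * R) ≤ 1.013 * M * (g * (1.03 * √n * (1.013 * 1.03 * √n))) :=
    (frobNorm_mul_le_of_right (by positivity) (h.vecNorm_mulVec_R_le hA hR) _).trans
      (mul_le_mul_of_nonneg_left ((h'.residual_le hS hZS).trans (mul_le_mul_of_nonneg_left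
        (mul_le_mul hZF hSF (frobNorm_nonneg _) (by positivity)) hg0)) (by positivity))
  have e2 : frobNorm (Y * R - X) ≤ g * (1.03 * √n * (1.013 * M * √n)) :=
    (h.residual_le hR hY).trans (mul_le_mul_of_nonneg_left
      (mul_le_mul hYF hRF (frobNorm_nonneg _) (by positivity)) hg0)
  have e3 : frobNorm (Z * (U - S * R)) ≤ 1.03 * (g * (1.013 * 1.03 * √n * (1.013 * M * √n))) :=
    (frobNorm_mul_le_of_left (by norm_num) (fun v => (h'.vecNorm_mulVec_Q hC hS hZS v).2) _).trans
      (mul_le_mul_of_nonneg_left (hE.trans (mul_le_mul_of_nonneg_left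
        (mul_le_mul hSF hRF (frobNorm_nonneg _) (by positivity)) hg0)) (by norm_num))
  have e0 : Z * U - X = (Z * S - Y) * R + (Y * R - X) + Z * (U - S * R) := by
    rw [Matrix.sub_mul, Matrix.mul_sub, Matrix.mul_assoc]
    abel
  have e4 := (frobNorm_add_le ((Z * S - Y) * R + (Y * R - X)) (Z * (U - S * R))).trans
    (add_le_add_left (frobNorm_add_le _ _) _)
  rw [← e0] at e4
  have e5 : frobNorm (Z * U - X) ≤ 3.3 * (g * (M * (√n * √n))) := by
    have : 0 ≤ g * (M * (√n * √n)) := by positivity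
    linarith
  rw [hss] at e5
  have e6 := mul_le_mul_of_nonneg_right hgn (mul_nonneg hM.le hn)
  have e7 : 0 ≤ (n : ℝ) ^ 2 * u * M := mul_nonneg (mul_nonneg (sq_nonneg _) h.nonneg) hM.le
  linarith

theorem sq_small_of_cond {u : ℝ} (hu : 0 ≤ u) {m n : ℕ} {X : Matrix (Fin m) (Fin n) ℝ}
    (hσ : 0 < (Matrix.toEuclideanLin X).singularValues (n - 1))
    (hcond : 8 * cond X * √((m : ℝ) * n * u + (n : ℝ) * (n + 1) * u) ≤ 1) :
    64 * ((m : ℝ) * n * u + (n : ℝ) * (n + 1) * u) * specNorm X ^ 2 ≤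
      (Matrix.toEuclideanLin X).singularValues (n - 1) ^ 2 := by
  set σ := (Matrix.toEuclideanLin X).singularValues (n - 1) with hσdef
  have hM : 0 ≤ specNorm X := norm_nonneg _
  have hc : cond X * σ = specNorm X := div_mul_cancel₀ _ hσ.ne'
  have hc0 : 0 ≤ cond X := div_nonneg hM hσ.le
  set ε := (m : ℝ) * n * u + (n : ℝ) * (n + 1) * u with hε
  have hε0 : 0 ≤ ε := by positivity
  have h1 := pow_le_pow_left₀ (by positivity) hcond 2
  rw [mul_pow, mul_pow, Real.sq_sqrt hε0] at h1
  have h2 := mul_le_mul_of_nonneg_right h1 (sq_nonneg σ)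
  rw [← hc]
  linarith

end FloatQR

theorem mainTheorem6 (m n : ℕ) (hmn : n ≤ m) (u : ℝ) (hu : 0 < u)
    (X : Matrix (Fin m) (Fin n) ℝ) (hX : X.rank = n)
    (hcond : 8 * FloatQR.cond X * √((m : ℝ) * n * u + (n : ℝ) * (n + 1) * u) ≤ 1) :
    ¬ FloatQR.CholeskyQR2BreaksDown u X ∧
      ∀ (Z : Matrix (Fin m) (Fin n) ℝ) (U : Matrix (Fin n) (Fin n) ℝ),
        FloatQR.CholeskyQR2 u X Z U →
          FloatQR.frobNorm (Z * U - X) ≤ 5 * (n : ℝ) ^ 2 * u * FloatQR.specNorm X := by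
  open FloatQR in
  rcases Nat.eq_zero_or_pos n with rfl | hn
  · refine ⟨?_, fun Z U _ => by simp [frobNorm]⟩
    rintro (⟨_, _, _, p, _⟩ | ⟨_, _, _, _, _, _, p, _⟩) <;> exact p.elim0
  have hσ := singularValues_pos_of_rank_eq hn hX
  have hsmall := sq_small_of_cond hu.le hσ hcond
  have hσM : (Matrix.toEuclideanLin X).singularValues (n - 1) ≤ specNorm X := by
    simpa [vecNorm_single] using (singularValues_mul_vecNorm_le X (Pi.single ⟨0, hn⟩ 1)).trans
      (vecNorm_mulVec_le_specNorm X _)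
  have hM := hσ.trans_le hσM
  have hε : 0 ≤ (m : ℝ) * n * u + (n : ℝ) * (n + 1) * u := by positivity
  have h : WellConditioned u X ((Matrix.toEuclideanLin X).singularValues (n - 1)) (specNorm X) :=
    { nonneg := hu.le
      pos := hn
      le := hmn
      sigma_pos := hσ
      sigma_le := hσM
      lower := singularValues_mul_vecNorm_le X
      upper := vecNorm_mulVec_le_specNorm X
      small := by linarith [mul_nonneg hε (sq_nonneg (specNorm X))] }
  have hε1 : 64 * ((m : ℝ) * n * u + (n : ℝ) * (n + 1) * u) ≤ 1 :=
    le_of_mul_le_mul_right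
      (by linarith [pow_le_pow_left₀ hσ.le hσM 2]) (pow_pos hM 2)
  have hstep : ∀ Y R, CholeskyQR u X Y R → WellConditioned u Y 0.97 1.03 := by
    rintro Y R ⟨A, hA, hR, hY⟩
    exact
      { nonneg := hu.le
        pos := hn
        le := hmn
        sigma_pos := by norm_num
        sigma_le := by norm_num
        lower := fun v => (h.vecNorm_mulVec_Q hA hR hY v).1
        upper := fun v => (h.vecNorm_mulVec_Q hA hR hY v).2
        small := by linarith }
  refine ⟨?_, fun Z U hZ => frobNorm_choleskyQR2_residual_le h hstep hZ⟩
  rintro (hb | ⟨Y, R, hYR, hb⟩)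
  · exact h.not_breaksDown hb
  · exact (hstep Y R hYR).not_breaksDown hb
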